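/- Let $L^2(\partial\mathbb D)$ be taken with respect to normalized arc length, and let $H^2\subset L^2(\partial\mathbb D)$ be the Hardy space of the unit disk $\mathbb D$, identified with its space of boundary functions. For a finite Blaschke product $$\alpha(z)=c\prod_{j=1}^{m}\frac{z-a_j}{1-\overline{a_j}z},\qquad |c|=1,\ |a_1|,\dots,|a_m|<1,$$ of degree $m$, let $K_\alpha=H^2\ominus\alpha H^2$ be the model space and let $P_\alpha$ be the orthogonal projection of $L^2(\partial\mathbb D)$ onto $K_\alpha$. For $w\in\overline{\mathbb D}$ let $$k_w^\alpha(z)=\frac{1-\overline{\alpha(w)}\,\alpha(z)}{1-\overline w z},\qquad \widetilde k_w^\alpha(z)=\frac{\alpha(z)-\alpha(w)}{z-w},$$ which are elements of $K_\alpha$. For finite Blaschke products $\alpha,\beta$ let $\mathscr T(\alpha,\beta)$ be the set of bounded operators $A\colon K_\alpha\to K_\beta$ for which there is a symbol $\varphi\in L^2(\partial\mathbb D)$ such that $Af=P_\beta(\varphi f)$ for all bounded $f\in K_\alpha$. For $g\in K_\beta$, $f\in K_\alpha$ let $(g\otimes f)(h)=\langle h,f\rangle g$. **Theorem.** Let $\alpha$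 and $\beta$ be finite Blaschke products of degree $m>0$ and $n>0$, respectively. The set of rank-one operators in $\mathscr T(\alpha,\beta)$ is equal to the set of all nonzero scalar multiples of the operators $\widetilde k_w^\beta\otimes k_w^\alpha$ and $k_w^\beta\otimes\widetilde k_w^\alpha$, $w\in\overline{\mathbb D}$, if and only if either $mn\le 2$, or both $m>1$ and $n>1$. -/

import Mathlib

open MeasureTheory AddCircle
open scoped ComplexConjugate Real

noncomputable section

namespace ModelSpace

instance fact_two_pi_pos : Fact ((0 : ℝ) < 2 * π) := ⟨Real.two_pi_pos⟩

/-- The parameter space of the unit circle: `t ∈ ℝ / 2πℤ` stands for the point `exp (i t)`. -/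
abbrev CircleParam : Type := AddCircle (2 * π)

/-- The point `exp (i t)` of the unit circle, as a complex number. -/
def circlePt (t : CircleParam) : ℂ := (AddCircle.toCircle t : ℂ)

/-- `L²` of the unit circle with respect to normalized arc length. -/
abbrev L2Circle : Type := Lp ℂ 2 (haarAddCircle : Measure CircleParam)

/-- `α` coincides on the closed unit disk with
`c * ∏ j, (z - a j) / (1 - conj (a j) * z)`, where `|c| = 1` and `|a j| < 1`, `j = 1, …, m`:
it is a finite Blaschke product of degree `m`. -/
def IsFiniteBlaschkeProduct (α : ℂ → ℂ) (m : ℕ) : Prop :=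
  ∃ (c : ℂ) (a : Fin m → ℂ), ‖c‖ = 1 ∧ (∀ j, ‖a j‖ < 1) ∧
    ∀ z : ℂ, ‖z‖ ≤ 1 → α z = c * ∏ j, (z - a j) / (1 - conj (a j) * z)

theorem fourierCoeff_eq_inner (f : L2Circle) (n : ℤ) :
    fourierCoeff (f : CircleParam → ℂ) n = inner ℂ (fourierBasis n : L2Circle) f := by
  rw [← fourierBasis_repr, HilbertBasis.repr_apply_apply]

/-- The Hardy space `H²`, through boundary values: the functions in `L²` of the circle
whose Fourier coefficients of negative index vanish. -/
def hardy : Submodule ℂ L2Circle where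
  carrier := {f | ∀ n : ℤ, n < 0 → fourierCoeff (f : CircleParam → ℂ) n = 0}
  zero_mem' := by
    intro n _
    rw [fourierCoeff_eq_inner, inner_zero_right]
  add_mem' := by
    intro f g hf hg n hn
    have hf' := hf n hn
    have hg' := hg n hn
    rw [fourierCoeff_eq_inner] at hf' hg' ⊢
    rw [inner_add_right, hf', hg', add_zero]
  smul_mem' := by
    intro c f hf n hn
    have hf' := hf n hn
    rw [fourierCoeff_eq_inner] at hf' ⊢
    rw [inner_smul_right, hf', mul_zero]

theorem isClosed_hardy : IsClosed (hardy : Set L2Circle) := by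
  have h : (hardy : Set L2Circle) =
      ⋂ n : ℤ, ⋂ _ : n < 0, {f : L2Circle | inner ℂ (fourierBasis n : L2Circle) f = 0} := by
    ext f
    simp only [Set.mem_iInter, Set.mem_ofPred_eq, ← fourierCoeff_eq_inner]
    rfl
  rw [h]
  exact isClosed_iInter fun n => isClosed_iInter fun _ =>
    isClosed_eq (continuous_const.inner continuous_id) continuous_const

/-- The subspace `α H²`, i.e. all elements of `L²` of the form `α h` with `h ∈ H²`. -/
def mulHardy (α : ℂ → ℂ) : Submodule ℂ L2Circle where
  carrier := {g | ∃ h ∈ hardy, ∀ᵐ t ∂(haarAddCircle : Measure CircleParam),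
    g t = α (circlePt t) * h t}
  zero_mem' := by
    refine ⟨0, hardy.zero_mem, ?_⟩
    filter_upwards [Lp.coeFn_zero ℂ 2 (haarAddCircle : Measure CircleParam)] with t ht
    rw [ht]; simp
  add_mem' := by
    rintro g₁ g₂ ⟨h₁, hh₁, e₁⟩ ⟨h₂, hh₂, e₂⟩
    refine ⟨h₁ + h₂, hardy.add_mem hh₁ hh₂, ?_⟩
    filter_upwards [e₁, e₂, Lp.coeFn_add g₁ g₂, Lp.coeFn_add h₁ h₂] with t a b c d
    rw [c, d, Pi.add_apply, Pi.add_apply, a, b, mul_add]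
  smul_mem' := by
    rintro r g ⟨h, hh, e⟩
    refine ⟨r • h, hardy.smul_mem r hh, ?_⟩
    filter_upwards [e, Lp.coeFn_smul r g, Lp.coeFn_smul r h] with t a c d
    rw [c, d, Pi.smul_apply, Pi.smul_apply, a, smul_eq_mul, smul_eq_mul, mul_left_comm]

/-- The model space `K_α = H² ⊖ α H²`. -/
def model (α : ℂ → ℂ) : Submodule ℂ L2Circle := hardy ⊓ (mulHardy α)ᗮ

instance completeSpace_model (α : ℂ → ℂ) : CompleteSpace (model α) :=
  (isClosed_hardy.inter (Submodule.isClosed_orthogonal (mulHardy α))).completeSpace_coe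

/-- `f ∈ K_α` is the kernel function `k_w^α (z) = (1 - conj (α w) α z) / (1 - conj w z)`.
(For `|w| = 1` the quotient is not given by the formula at the single point `z = w`,
which is a null set.) -/
def IsKernel (α : ℂ → ℂ) (w : ℂ) (f : model α) : Prop :=
  ∀ᵐ t ∂(haarAddCircle : Measure CircleParam), (f : L2Circle) t =
    (1 - conj (α w) * α (circlePt t)) / (1 - conj w * circlePt t)

/-- `f ∈ K_α` is the conjugate kernel function `(α z - α w) / (z - w)`. -/
def IsConjKernel (α : ℂ → ℂ) (w : ℂ) (f : model α) : Prop :=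
  ∀ᵐ t ∂(haarAddCircle : Measure CircleParam), (f : L2Circle) t =
    (α (circlePt t) - α w) / (circlePt t - w)

/-- The set `𝒯(α, β)` of bounded operators `A : K_α → K_β` for which there is a symbol
`φ ∈ L²` with `A f = P_β (φ f)` for all bounded functions `f ∈ K_α`. -/
def asymTruncToeplitz (α β : ℂ → ℂ) : Set (model α →L[ℂ] model β) :=
  {A | ∃ φ : L2Circle, ∀ f : model α,
    MemLp ((f : L2Circle) : CircleParam → ℂ) ⊤ (haarAddCircle : Measure CircleParam) →
      ∃ h : L2Circle,
        (∀ᵐ t ∂(haarAddCircle : Measure CircleParam), h t = φ t * (f : L2Circle) t) ∧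
        A f = (model β).orthogonalProjectionOnto h}

/-- The operators of rank one in `𝒯(α, β)`. -/
def rankOneToeplitz (α β : ℂ → ℂ) : Set (model α →L[ℂ] model β) :=
  {A | A ∈ asymTruncToeplitz α β ∧ Module.finrank ℂ (LinearMap.range A.toLinearMap) = 1}

/-- The nonzero scalar multiples of the operators `k̃_w^β ⊗ k_w^α` and `k_w^β ⊗ k̃_w^α`,
`|w| ≤ 1`, where `(g ⊗ f) h = ⟨h, f⟩ g`. -/
def kernelTensors (α β : ℂ → ℂ) : Set (model α →L[ℂ] model β) :=
  {A | ∃ w : ℂ, ‖w‖ ≤ 1 ∧ ∃ c : ℂ, c ≠ 0 ∧ ∃ (f : model α) (g : model β),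
    ((IsConjKernel β w g ∧ IsKernel α w f) ∨ (IsKernel β w g ∧ IsConjKernel α w f)) ∧
    A = c • InnerProductSpace.rankOne ℂ g f}

end ModelSpace

end

/-!
Multiplying by the denominator `∏ (1 - conj (a j) z)` of `α` turns `K_α` into the polynomials of
degree less than `m`. In the bases `e i = z ^ i / ∏ (1 - conj (a j) z)` of `K_α` and, with the
order reversed, `f j` of `K_β`, the product `conj (f j) * e i` is `z ^ (i + j)` times a fixed
invertible function, so the matrices `⟨f j, A (e i)⟩` of the operators `A` in `𝒯(α, β)` are
exactly the `m × n` Hankel matrices, given by sequences `(l 0, …, l (m + n - 2))`.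

The kernel functions have geometric progressions as inner products with these bases. The multiples
of `k̃_w^β ⊗ k_w^α` thus belong to the sequences `C * w ^ k`, those of `k_w^β ⊗ k̃_w^α` to the
sequences `C * conj w ^ (m + n - 2 - k)`. As `w` runs through the closed unit disk, together they
fill the cone over the rational normal curve of degree `m + n - 2`.

It remains to see when all Hankel matrices of rank one come from this curve. If `m, n > 1`, the
curve is cut out by the `2 × 2` minors. If `m + n - 2 ≤ 1`, every nonzero sequence lies on it. A
single row or column of length at least three is always of rank one, but `(0, 1, 0, …, 0)` is not
on the curve.
-/

noncomputable section

namespace ModelSpace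

section Hankel

/-- The `m × n` Hankel matrix of the sequence `l`. Rows and columns are numbered from `0`, so that
its entries are `l 0, …, l (m + n - 2)`. -/
def hankel {R : Type*} (m n : ℕ) (l : ℕ → R) : Matrix (Fin m) (Fin n) R := .of fun i j => l (i + j)

theorem hankel_congr {R : Type*} {m n : ℕ} {l l' : ℕ → R} (h : ∀ k ≤ m + n - 2, l k = l' k) :
    hankel m n l = hankel m n l' := by
  ext i j
  exact h _ (by omega)

theorem eq_of_hankel_eq_hankel {R : Type*} {m n : ℕ} (hm : 0 < m) (hn : 0 < n) {l l' : ℕ → R}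
    (h : hankel m n l = hankel m n l') {k : ℕ} (hk : k ≤ m + n - 2) : l k = l' k := by
  obtain ⟨i, j, hi, hj, rfl⟩ : ∃ i j, i < m ∧ j < n ∧ k = i + j :=
    ⟨min k (m - 1), k - min k (m - 1), by omega, by omega, by omega⟩
  exact congrFun₂ h ⟨i, hi⟩ ⟨j, hj⟩

theorem smul_hankel {M R : Type*} [SMul M R] (c : M) (m n : ℕ) (l : ℕ → R) :
    c • hankel m n l = hankel m n (c • l) :=
  rfl

theorem exists_ne_zero_of_hankel_ne_zero {R : Type*} [Zero R] {m n : ℕ} {l : ℕ → R}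
    (h : hankel m n l ≠ 0) : ∃ k ≤ m + n - 2, l k ≠ 0 := by
  contrapose! h
  ext i j
  exact h _ (by omega)

theorem mul_eq_mul_of_hankel_eq_vecMulVec {R : Type*} [CommSemigroup R] {m n : ℕ} {l : ℕ → R}
    {x : Fin m → R} {y : Fin n → R} (h : hankel m n l = Matrix.vecMulVec x y) {i i' j j' : ℕ}
    (hi : i < m) (hi' : i' < m) (hj : j < n) (hj' : j' < n) :
    l (i + j) * l (i' + j') = l (i + j') * l (i' + j) := by
  have entry {i j : ℕ} (hi : i < m) (hj : j < n) : l (i + j) = x ⟨i, hi⟩ * y ⟨j, hj⟩ :=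
    congrFun₂ h ⟨i, hi⟩ ⟨j, hj⟩
  rw [entry hi hj, entry hi' hj', entry hi hj', entry hi' hj, mul_mul_mul_comm,
    mul_mul_mul_comm (x _) (y ⟨j', _⟩), mul_comm (y ⟨j, _⟩)]

theorem vecMulVec_ne_zero {R ι κ : Type*} [MulZeroClass R] [NoZeroDivisors R] {x : ι → R}
    {y : κ → R} (hx : x ≠ 0) (hy : y ≠ 0) : Matrix.vecMulVec x y ≠ 0 := by
  obtain ⟨i, hi⟩ := Function.ne_iff.mp hx
  obtain ⟨j, hj⟩ := Function.ne_iff.mp hy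
  exact fun h => mul_ne_zero hi hj (congrFun₂ h i j)

variable {K : Type*} [Field K] {m n N : ℕ} {l : ℕ → K}

/-- `(l 0, …, l N)` is a nonzero point of the cone over the rational normal curve of degree `N`:
it is proportional to `(s ^ N, s ^ (N - 1) * t, …, t ^ N)` for some point `(s : t)` of the
projective line. -/
def OnRationalNormalCurve (N : ℕ) (l : ℕ → K) : Prop :=
  ∃ C s t : K, C ≠ 0 ∧ (s ≠ 0 ∨ t ≠ 0) ∧ ∀ k ≤ N, l k = C * (s ^ (N - k) * t ^ k)

theorem OnRationalNormalCurve.congr {l' : ℕ → K} (h : OnRationalNormalCurve N l)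
    (heq : ∀ k ≤ N, l' k = l k) : OnRationalNormalCurve N l' :=
  let ⟨C, s, t, hC, hst, h⟩ := h
  ⟨C, s, t, hC, hst, fun k hk => (heq k hk).trans (h k hk)⟩

theorem OnRationalNormalCurve.smul (h : OnRationalNormalCurve N l) {c : K} (hc : c ≠ 0) :
    OnRationalNormalCurve N (c • l) :=
  let ⟨C, s, t, hC, hst, h⟩ := h
  ⟨c * C, s, t, mul_ne_zero hc hC, hst, fun k hk => by
    rw [Pi.smul_apply, h k hk, smul_eq_mul, mul_assoc]⟩

theorem onRationalNormalCurve_geometric {C : K} (hC : C ≠ 0) (w : K) (N : ℕ) :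
    OnRationalNormalCurve N fun k => C * w ^ k :=
  ⟨C, 1, w, hC, Or.inl one_ne_zero, fun k _ => by rw [one_pow, one_mul]⟩

theorem onRationalNormalCurve_geometric_rev {C : K} (hC : C ≠ 0) (w : K) (N : ℕ) :
    OnRationalNormalCurve N fun k => C * w ^ (N - k) :=
  ⟨C, w, 1, hC, Or.inr one_ne_zero, fun k _ => by rw [one_pow, mul_one]⟩

theorem eq_mul_pow_of_hankel_minors (hm : 1 < m) (hn : 1 < n)
    (minors : ∀ i i' j j', i < m → i' < m → j < n → j' < n →
      l (i + j) * l (i' + j') = l (i + j') * l (i' + j)) (h0 : l 0 ≠ 0) :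
    ∀ k ≤ m + n - 2, l k = l 0 * (l 1 / l 0) ^ k := by
  intro k
  induction k using Nat.strong_induction_on with
  | _ k ih =>
    intro hk
    obtain rfl | rfl | hk2 : k = 0 ∨ k = 1 ∨ 2 ≤ k := by omega
    · simp
    · rw [pow_one, mul_div_cancel₀ _ h0]
    obtain ⟨i, j, hi0, hj0, hi, hj, rfl⟩ :
        ∃ i j, 0 < i ∧ 0 < j ∧ i < m ∧ j < n ∧ k = i + j :=
      ⟨min (k - 1) (m - 1), k - min (k - 1) (m - 1), by omega, by omega, by omega, by omega,
        by omega⟩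
    have minor : l (i + j) * l 0 = l i * l j := by
      simpa using minors i 0 j 0 hi (by omega) hj (by omega)
    rw [ih i (by omega) (by omega), ih j (by omega) (by omega)] at minor
    refine mul_right_cancel₀ h0 (minor.trans ?_)
    ring

theorem eq_zero_of_hankel_minors (hm : 1 < m) (hn : 1 < n)
    (minors : ∀ i i' j j', i < m → i' < m → j < n → j' < n →
      l (i + j) * l (i' + j') = l (i + j') * l (i' + j)) (h0 : l 0 = 0) :
    ∀ k < m + n - 2, l k = 0 := by
  intro k
  induction k with
  | zero => exact fun _ => h0
  | succ k ih =>
    intro hk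
    obtain ⟨i, j, hi, hj, rfl⟩ : ∃ i j, i + 1 < m ∧ j + 1 < n ∧ k = i + j :=
      ⟨min k (m - 2), k - min k (m - 2), by omega, by omega, by omega⟩
    have minor : l (i + j + 1) * l (i + j + 1) = l (i + j) * l (i + j + 2) := by
      convert minors i (i + 1) (j + 1) j (by omega) hi hj (by omega) using 3 <;> ring
    rwa [ih (by omega), zero_mul, mul_self_eq_zero] at minor

theorem onRationalNormalCurve_of_hankel_minors (hm : 1 < m) (hn : 1 < n)
    (minors : ∀ i i' j j', i < m → i' < m → j < n → j' < n →
      l (i + j) * l (i' + j') = l (i + j') * l (i' + j)) (hl : ∃ k ≤ m + n - 2, l k ≠ 0) :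
    OnRationalNormalCurve (m + n - 2) l := by
  by_cases h0 : l 0 = 0
  · have vanish := eq_zero_of_hankel_minors hm hn minors h0
    obtain ⟨k, hk, hlk⟩ := hl
    obtain rfl : k = m + n - 2 := hk.eq_of_not_lt fun hlt => hlk (vanish k hlt)
    refine ⟨l (m + n - 2), 0, 1, hlk, Or.inr one_ne_zero, fun i hi => ?_⟩
    rcases hi.eq_or_lt with rfl | hlt
    · simp
    · rw [vanish i hlt, zero_pow (by omega), zero_mul, mul_zero]
  · refine ⟨l 0, 1, l 1 / l 0, h0, Or.inl one_ne_zero, fun k hk => ?_⟩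
    rw [one_pow, one_mul]
    exact eq_mul_pow_of_hankel_minors hm hn minors h0 k hk

theorem onRationalNormalCurve_of_le_one (hN : N ≤ 1) (hl : ∃ k ≤ N, l k ≠ 0) :
    OnRationalNormalCurve N l := by
  obtain ⟨k, hk, hlk⟩ := hl
  obtain rfl | rfl : N = 0 ∨ N = 1 := by omega
  · obtain rfl : k = 0 := by omega
    exact ⟨l 0, 1, 0, hlk, Or.inl one_ne_zero, fun i hi => by simp [Nat.le_zero.mp hi]⟩
  · refine ⟨1, l 0, l 1, one_ne_zero, ?_, fun i hi => ?_⟩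
    · obtain rfl | rfl : k = 0 ∨ k = 1 := by omega
      exacts [Or.inl hlk, Or.inr hlk]
    · obtain rfl | rfl : i = 0 ∨ i = 1 := by omega
      all_goals simp

theorem not_onRationalNormalCurve_single_one (hN : 2 ≤ N) :
    ¬OnRationalNormalCurve N (Pi.single 1 1 : ℕ → K) := by
  rintro ⟨C, s, t, hC, -, h⟩
  have hs : s = 0 := by simpa [hC, show N ≠ 0 by omega] using (h 0 (by omega)).symm
  have h1 := h 1 (by omega)
  rw [hs, zero_pow (by omega), zero_mul, mul_zero, Pi.single_eq_same] at h1
  exact one_ne_zero h1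

theorem OnRationalNormalCurve.exists_hankel_eq_vecMulVec (hm : 0 < m) (hn : 0 < n)
    (h : OnRationalNormalCurve (m + n - 2) l) :
    ∃ x ≠ 0, ∃ y ≠ 0, hankel m n l = Matrix.vecMulVec x y := by
  obtain ⟨C, s, t, hC, hst, h⟩ := h
  have pow_ne {p : ℕ} (hp : 0 < p) : (fun i : Fin p => s ^ (p - 1 - i : ℕ) * t ^ (i : ℕ)) ≠ 0 := by
    intro h0
    rcases hst with hs | ht
    · simpa [hs] using congrFun h0 ⟨0, hp⟩
    · simpa [ht] using congrFun h0 ⟨p - 1, by omega⟩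
  refine ⟨C • _, smul_ne_zero hC (pow_ne hm), _, pow_ne hn, ?_⟩
  ext i j
  simp only [hankel, Matrix.of_apply, Matrix.vecMulVec_apply, Pi.smul_apply, smul_eq_mul]
  rw [h _ (by omega), show m + n - 2 - (i + j : ℕ) = (m - 1 - i) + (n - 1 - j) by omega]
  ring

theorem exists_hankel_single_one_eq_vecMulVec (hmn : 2 < m * n) (h : ¬(1 < m ∧ 1 < n)) :
    ∃ x ≠ 0, ∃ y ≠ 0, hankel m n (Pi.single 1 1 : ℕ → K) = Matrix.vecMulVec x y := by
  obtain rfl | rfl : m = 1 ∨ n = 1 := by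
    rcases not_and_or.mp h with h | h
    · exact Or.inl (by have := Nat.pos_of_mul_pos_right (by omega : 0 < m * n); omega)
    · exact Or.inr (by have := Nat.pos_of_mul_pos_left (by omega : 0 < m * n); omega)
  · refine ⟨1, one_ne_zero, fun j => Pi.single (M := fun _ => K) 1 1 (j : ℕ), ?_, ?_⟩
    · exact fun h0 => by simpa using congrFun h0 ⟨1, by omega⟩
    · ext i j
      simp [hankel, Matrix.vecMulVec_apply]
  · refine ⟨fun i => Pi.single (M := fun _ => K) 1 1 (i : ℕ), ?_, 1, one_ne_zero, ?_⟩
    · exact fun h0 => by simpa using congrFun h0 ⟨1, by omega⟩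
    · ext i j
      simp [hankel, Matrix.vecMulVec_apply]

theorem forall_onRationalNormalCurve_iff (hm : 0 < m) (hn : 0 < n) :
    (∀ l : ℕ → K, (∃ x ≠ 0, ∃ y ≠ 0, hankel m n l = Matrix.vecMulVec x y) →
        OnRationalNormalCurve (m + n - 2) l) ↔
      m * n ≤ 2 ∨ (1 < m ∧ 1 < n) := by
  constructor
  · intro h
    by_contra hmn
    rw [not_or, not_le] at hmn
    have hN : 2 ≤ m + n - 2 := by
      rcases hmn with ⟨hlt, -⟩
      by_contra hN
      have hbound : m + n ≤ 3 := by omega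
      have hm3 : m ≤ 3 := by omega
      interval_cases m <;> omega
    exact not_onRationalNormalCurve_single_one hN
      (h _ (exists_hankel_single_one_eq_vecMulVec hmn.1 hmn.2))
  · rintro hmn l ⟨x, hx, y, hy, hl⟩
    have hl0 : ∃ k ≤ m + n - 2, l k ≠ 0 :=
      exists_ne_zero_of_hankel_ne_zero (hl ▸ vecMulVec_ne_zero hx hy)
    by_cases h : 1 < m ∧ 1 < n
    · exact onRationalNormalCurve_of_hankel_minors h.1 h.2 (fun i i' j j' hi hi' hj hj' =>
        mul_eq_mul_of_hankel_eq_vecMulVec hl hi hi' hj hj') hl0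
    · have hN : m + n - 2 ≤ 1 := by
        have hle : m * n ≤ 2 := hmn.resolve_right h
        obtain rfl | rfl : m = 1 ∨ n = 1 := by omega
        all_goals omega
      exact onRationalNormalCurve_of_le_one hN hl0

end Hankel

theorem OnRationalNormalCurve.exists_norm_le_one {K : Type*} [NormedField K] {N : ℕ} {l : ℕ → K}
    (h : OnRationalNormalCurve N l) :
    ∃ w : K, ‖w‖ ≤ 1 ∧ ∃ C ≠ 0,
      (∀ k ≤ N, l k = C * w ^ k) ∨ ∀ k ≤ N, l k = C * w ^ (N - k) := by
  obtain ⟨C, s, t, hC, hst, h⟩ := h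
  rcases le_total ‖t‖ ‖s‖ with hle | hle
  · have hs : s ≠ 0 := by
      rintro rfl
      simp_all
    refine ⟨t / s, ?_, C * s ^ N, mul_ne_zero hC (pow_ne_zero N hs), Or.inl fun k hk => ?_⟩
    · rw [norm_div]
      exact div_le_one_of_le₀ hle (norm_nonneg s)
    · rw [h k hk, ← pow_sub_mul_pow s hk, div_pow]
      field_simp
  · have ht : t ≠ 0 := by
      rintro rfl
      simp_all
    refine ⟨s / t, ?_, C * t ^ N, mul_ne_zero hC (pow_ne_zero N ht), Or.inr fun k hk => ?_⟩
    · rw [norm_div]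
      exact div_le_one_of_le₀ hle (norm_nonneg t)
    · rw [h k hk, ← pow_sub_mul_pow t hk, div_pow]
      field_simp

section Gram

open InnerProductSpace

variable {𝕜 E F ι κ : Type*} [RCLike 𝕜] [NormedAddCommGroup E] [InnerProductSpace 𝕜 E]
  [NormedAddCommGroup F] [InnerProductSpace 𝕜 F]

/-- The matrix `⟨b' j, A (b i)⟩` of the sesquilinear form of `A` in two bases, which need not be
orthonormal. Rows are indexed by the basis of the domain. -/
def gram (b : Module.Basis ι 𝕜 E) (b' : Module.Basis κ 𝕜 F) (A : E →L[𝕜] F) : Matrix ι κ 𝕜 :=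
  .of fun i j => inner 𝕜 (b' j) (A (b i))

variable (b : Module.Basis ι 𝕜 E) (b' : Module.Basis κ 𝕜 F)

theorem gram_injective : Function.Injective (gram b b') := by
  intro A A' h
  exact ContinuousLinearMap.coe_injective (b.ext fun i => ext_inner_left_basis b' (congrFun₂ h i))

theorem gram_smul (c : 𝕜) (A : E →L[𝕜] F) : gram b b' (c • A) = c • gram b b' A := by
  ext i j
  simp [gram, inner_smul_right]

theorem gram_rankOne (g : F) (f : E) :
    gram b b' (rankOne 𝕜 g f) =
      Matrix.vecMulVec (fun i => inner 𝕜 f (b i)) (fun j => inner 𝕜 (b' j) g) := by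
  ext i j
  simp [gram, Matrix.vecMulVec_apply, inner_smul_right]

theorem exists_forall_inner_basis_right_eq [FiniteDimensional 𝕜 E] (x : ι → 𝕜) :
    ∃ f : E, ∀ i, inner 𝕜 f (b i) = x i := by
  have : CompleteSpace E := FiniteDimensional.complete 𝕜 E
  refine ⟨(toDual 𝕜 E).symm (LinearMap.toContinuousLinearMap (b.constr 𝕜 x)), fun i => ?_⟩
  rw [toDual_symm_apply, LinearMap.coe_toContinuousLinearMap', b.constr_basis]

theorem exists_forall_inner_basis_left_eq [FiniteDimensional 𝕜 F] (y : κ → 𝕜) :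
    ∃ g : F, ∀ j, inner 𝕜 (b' j) g = y j := by
  obtain ⟨g, hg⟩ := exists_forall_inner_basis_right_eq b' (star y)
  exact ⟨g, fun j => by rw [← inner_conj_symm, hg, Pi.star_apply, starRingEnd_apply, star_star]⟩

theorem exists_gram_eq_vecMulVec [FiniteDimensional 𝕜 E] [FiniteDimensional 𝕜 F]
    (x : ι → 𝕜) (y : κ → 𝕜) :
    ∃ (f : E) (g : F), gram b b' (rankOne 𝕜 g f) = Matrix.vecMulVec x y := by
  obtain ⟨f, hf⟩ := exists_forall_inner_basis_right_eq b x
  obtain ⟨g, hg⟩ := exists_forall_inner_basis_left_eq b' y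
  exact ⟨f, g, by rw [gram_rankOne, funext hf, funext hg]⟩

theorem finrank_range_eq_one_iff_exists_gram_eq [FiniteDimensional 𝕜 E] [FiniteDimensional 𝕜 F]
    (A : E →L[𝕜] F) :
    Module.finrank 𝕜 (LinearMap.range A.toLinearMap) = 1 ↔
      ∃ x ≠ 0, ∃ y ≠ 0, gram b b' A = Matrix.vecMulVec x y := by
  constructor
  · intro hA
    obtain ⟨⟨g, hg⟩, hg0, span⟩ := finrank_eq_one_iff'.mp hA
    choose x hx using fun i => span ⟨A (b i), LinearMap.mem_range_self _ (b i)⟩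
    have hAb (i : ι) : A (b i) = x i • g := (congrArg Subtype.val (hx i)).symm
    refine ⟨x, ?_, fun j => inner 𝕜 (b' j) g, ?_, ?_⟩
    · rintro rfl
      have hA0 : A.toLinearMap = 0 := b.ext fun i => by simp [hAb]
      rw [hA0, LinearMap.range_zero, finrank_bot] at hA
      exact zero_ne_one hA
    · intro h0
      refine hg0 (Subtype.ext (ext_inner_left_basis b' fun j => ?_))
      rw [congrFun h0 j, Pi.zero_apply, ZeroMemClass.coe_zero, inner_zero_right]
    · ext i j
      simp [gram, Matrix.vecMulVec_apply, hAb, inner_smul_right]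
  · rintro ⟨x, hx, y, hy, h⟩
    obtain ⟨f, g, hfg⟩ := exists_gram_eq_vecMulVec b b' x y
    obtain rfl : A = rankOne 𝕜 g f := gram_injective b b' (h.trans hfg.symm)
    have nonzero : g ≠ 0 ∧ f ≠ 0 := by
      refine not_or.mp fun h0 => vecMulVec_ne_zero hx hy ?_
      rw [← h]
      ext i j
      rcases h0 with rfl | rfl <;> simp [gram]
    exact Module.rank_eq_one_iff_finrank_eq_one.mp (rank_rankOne nonzero.1 nonzero.2)

end Gram

section Multiplication

variable {X 𝕜 : Type*} [RCLike 𝕜] [TopologicalSpace X] [CompactSpace X] [MeasurableSpace X]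
  [BorelSpace X] (μ : Measure X) [IsFiniteMeasure μ]

/-- Multiplication by `φ` on `L²`, as a bounded operator. It underlies the representation
`multiplication` of the algebra of continuous functions. -/
def mulCLM (φ : C(X, 𝕜)) : Lp 𝕜 2 μ →L[𝕜] Lp 𝕜 2 μ :=
  (ContinuousLinearMap.mul 𝕜 𝕜).holderL μ ⊤ 2 2 (ContinuousMap.toLp ⊤ μ 𝕜 φ)

theorem coeFn_mulCLM (φ : C(X, 𝕜)) (f : Lp 𝕜 2 μ) :
    mulCLM μ φ f =ᵐ[μ] fun t => φ t * f t := by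
  filter_upwards [(ContinuousLinearMap.mul 𝕜 𝕜).coeFn_holder (r := 2)
      (ContinuousMap.toLp ⊤ μ 𝕜 φ) f,
    ContinuousMap.coeFn_toLp (p := ⊤) (𝕜 := 𝕜) μ φ] with t hprod hφ
  rw [← hφ]
  exact hprod

theorem mulCLM_one : mulCLM μ (1 : C(X, 𝕜)) = 1 := by
  ext1 f
  apply Lp.ext
  filter_upwards [coeFn_mulCLM μ (1 : C(X, 𝕜)) f] with t h
  rw [h, ContinuousMap.one_apply, one_mul, one_apply_eq_self]

theorem mulCLM_mul (φ ψ : C(X, 𝕜)) : mulCLM μ (φ * ψ) = mulCLM μ φ * mulCLM μ ψ := by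
  ext1 f
  apply Lp.ext
  filter_upwards [coeFn_mulCLM μ (φ * ψ) f, coeFn_mulCLM μ φ (mulCLM μ ψ f),
    coeFn_mulCLM μ ψ f] with t h₁ h₂ h₃
  rw [h₁, mul_apply_eq_comp, h₂, h₃, ContinuousMap.mul_apply, mul_assoc]

theorem inner_mulCLM_right (φ : C(X, 𝕜)) (f g : Lp 𝕜 2 μ) :
    inner 𝕜 f (mulCLM μ φ g) = inner 𝕜 (mulCLM μ (star φ) f) g := by
  rw [L2.inner_def, L2.inner_def]
  apply integral_congr_ae
  filter_upwards [coeFn_mulCLM μ φ g, coeFn_mulCLM μ (star φ) f] with t h₁ h₂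
  rw [h₁, h₂]
  simp only [RCLike.inner_apply, ContinuousMap.star_apply, map_mul, RCLike.star_def,
    RCLike.conj_conj]
  ring

/-- The representation of the continuous functions by multiplication operators on `L²`. -/
def multiplication : C(X, 𝕜) →⋆ₐ[𝕜] (Lp 𝕜 2 μ →L[𝕜] Lp 𝕜 2 μ) where
  toFun := mulCLM μ
  map_one' := mulCLM_one μ
  map_mul' := mulCLM_mul μ
  map_zero' := by simp [mulCLM]
  map_add' := by simp [mulCLM]
  commutes' r := by
    have hsmul : mulCLM μ (r • (1 : C(X, 𝕜))) = r • mulCLM μ 1 := by simp [mulCLM]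
    rw [Algebra.algebraMap_eq_smul_one, Algebra.algebraMap_eq_smul_one, hsmul, mulCLM_one]
  map_star' φ := by
    rw [ContinuousLinearMap.star_eq_adjoint, ContinuousLinearMap.eq_adjoint_iff]
    exact fun f g => (inner_mulCLM_right μ φ f g).symm

theorem coeFn_multiplication (φ : C(X, 𝕜)) (f : Lp 𝕜 2 μ) :
    multiplication μ φ f =ᵐ[μ] fun t => φ t * f t :=
  coeFn_mulCLM μ φ f

theorem multiplication_mul_apply (φ ψ : C(X, 𝕜)) (f : Lp 𝕜 2 μ) :
    multiplication μ (φ * ψ) f = multiplication μ φ (multiplication μ ψ f) := by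
  rw [map_mul, mul_apply_eq_comp]

theorem multiplication_toLp (φ ψ : C(X, 𝕜)) :
    multiplication μ φ (ContinuousMap.toLp 2 μ 𝕜 ψ) = ContinuousMap.toLp 2 μ 𝕜 (φ * ψ) := by
  apply Lp.ext
  filter_upwards [coeFn_multiplication μ φ (ContinuousMap.toLp 2 μ 𝕜 ψ),
    ContinuousMap.coeFn_toLp (p := 2) (𝕜 := 𝕜) μ ψ,
    ContinuousMap.coeFn_toLp (p := 2) (𝕜 := 𝕜) μ (φ * ψ)] with t h₁ h₂ h₃
  rw [h₁, h₂, h₃, ContinuousMap.mul_apply]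

theorem multiplication_eq_toLp_iff {ψ : C(X, 𝕜)} (hψ : ∀ᵐ t ∂μ, ψ t ≠ 0) (φ : C(X, 𝕜))
    (f : Lp 𝕜 2 μ) :
    multiplication μ ψ f = ContinuousMap.toLp 2 μ 𝕜 φ ↔ f =ᵐ[μ] fun t => φ t / ψ t := by
  rw [Lp.ext_iff]
  refine Filter.eventually_congr ?_
  filter_upwards [hψ, coeFn_multiplication μ ψ f,
    ContinuousMap.coeFn_toLp (p := 2) (𝕜 := 𝕜) μ φ] with t hne hmul hφ
  rw [hmul, hφ, eq_div_iff hne, mul_comm (f t)]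

theorem inner_multiplication_right (φ : C(X, 𝕜)) (f g : Lp 𝕜 2 μ) :
    inner 𝕜 f (multiplication μ φ g) = inner 𝕜 (multiplication μ (star φ) f) g :=
  inner_mulCLM_right μ φ f g

theorem continuous_multiplication :
    Continuous (multiplication μ : C(X, 𝕜) → Lp 𝕜 2 μ →L[𝕜] Lp 𝕜 2 μ) :=
  ((ContinuousLinearMap.mul 𝕜 𝕜).holderL μ ⊤ 2 2).continuous.comp
    (ContinuousMap.toLp ⊤ μ 𝕜).continuous

theorem inner_toLp_star (φ ψ : C(X, 𝕜)) :
    inner 𝕜 (ContinuousMap.toLp 2 μ 𝕜 φ) (ContinuousMap.toLp 2 μ 𝕜 (star ψ)) =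
      inner 𝕜 (ContinuousMap.toLp 2 μ 𝕜 ψ) (ContinuousMap.toLp 2 μ 𝕜 (star φ)) := by
  rw [ContinuousMap.inner_toLp, ContinuousMap.inner_toLp]
  simp only [ContinuousMap.star_apply, RCLike.star_def, mul_comm]

end Multiplication

section Hardy

/-- Continuous functions on the circle as elements of `L²`. -/
abbrev toL2 : C(CircleParam, ℂ) →L[ℂ] L2Circle :=
  ContinuousMap.toLp 2 (haarAddCircle : Measure CircleParam) ℂ

/-- Multiplication operators on `L²` of the circle. -/
abbrev mulL2 : C(CircleParam, ℂ) →⋆ₐ[ℂ] (L2Circle →L[ℂ] L2Circle) :=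
  multiplication (haarAddCircle : Measure CircleParam)

/-- The coordinate function `z` of the circle. -/
abbrev zC : C(CircleParam, ℂ) := fourier 1

theorem norm_circlePt (t : CircleParam) : ‖circlePt t‖ = 1 := Circle.norm_coe _

theorem ae_circlePt_ne (w : ℂ) :
    ∀ᵐ t ∂(haarAddCircle : Measure CircleParam), circlePt t ≠ w := by
  have hsub : {t : CircleParam | circlePt t = w}.Subsingleton := fun s hs t ht =>
    injective_toCircle Real.two_pi_pos.ne' (Circle.coe_injective (hs.trans ht.symm))
  have : Nontrivial Circle := ⟨_, _, Circle.neg_ne_self 1⟩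
  have : Nontrivial CircleParam := (homeomorphCircle Real.two_pi_pos.ne').surjective.nontrivial
  simpa [ae_iff] using hsub.measure_zero haarAddCircle

theorem fourier_zero_eq_one : (fourier 0 : C(CircleParam, ℂ)) = 1 := by
  ext t
  exact fourier_zero

theorem fourier_mul_fourier (k l : ℤ) :
    (fourier k * fourier l : C(CircleParam, ℂ)) = fourier (k + l) := by
  ext t
  rw [ContinuousMap.mul_apply, fourier_add]

theorem star_fourier (k : ℤ) : star (fourier k : C(CircleParam, ℂ)) = fourier (-k) := by
  ext t
  rw [ContinuousMap.star_apply, RCLike.star_def, fourier_neg]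

theorem zC_pow (k : ℕ) : zC ^ k = fourier (k : ℤ) := by
  induction k with
  | zero => rw [pow_zero, Nat.cast_zero, fourier_zero_eq_one]
  | succ k ih => rw [pow_succ, ih, fourier_mul_fourier, Nat.cast_succ]

theorem star_zC_pow_mul (k : ℕ) : star (zC ^ k) * zC ^ k = 1 := by
  rw [zC_pow, star_fourier, fourier_mul_fourier, neg_add_cancel, fourier_zero_eq_one]

theorem star_zC_mul_zC : star zC * zC = 1 := by
  simpa only [pow_one] using star_zC_pow_mul 1

theorem inner_toL2_fourier (k : ℤ) (f : L2Circle) :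
    inner ℂ (toL2 (fourier k)) f = fourierCoeff f k := by
  rw [fourierCoeff_eq_inner, coe_fourierBasis]

theorem ext_fourierCoeff {f g : L2Circle} (h : ∀ k, fourierCoeff f k = fourierCoeff g k) :
    f = g := by
  refine (fourierBasis (T := 2 * π)).repr.injective (lp.ext (funext fun k => ?_))
  rw [fourierBasis_repr, fourierBasis_repr, h]

theorem fourierCoeff_mulL2_fourier (k l : ℤ) (f : L2Circle) :
    fourierCoeff (mulL2 (fourier l) f) k = fourierCoeff f (k - l) := by
  rw [← inner_toL2_fourier, inner_multiplication_right, multiplication_toLp, star_fourier,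
    fourier_mul_fourier, neg_add_eq_sub, inner_toL2_fourier]

theorem fourierCoeff_toL2_fourier (k l : ℤ) :
    fourierCoeff (toL2 (fourier l)) k = if k = l then 1 else 0 := by
  rw [← inner_toL2_fourier]
  exact orthonormal_iff_ite.mp (orthonormal_fourier (T := 2 * π)) k l

theorem fourierCoeff_toL2_star (ψ : C(CircleParam, ℂ)) (k : ℤ) :
    fourierCoeff (toL2 (star ψ)) k = conj (fourierCoeff (toL2 ψ) (-k)) := by
  rw [← inner_toL2_fourier, inner_toLp_star, star_fourier, ← inner_conj_symm, inner_toL2_fourier]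

theorem eq_sum_of_fourierCoeff_eq_zero {f : L2Circle} (s : Finset ℤ)
    (h : ∀ k ∉ s, fourierCoeff f k = 0) :
    f = ∑ k ∈ s, fourierCoeff f k • toL2 (fourier k) := by
  refine ext_fourierCoeff fun k => ?_
  rw [← inner_toL2_fourier k (∑ _ ∈ s, _), inner_sum]
  simp only [inner_smul_right, inner_toL2_fourier, fourierCoeff_toL2_fourier, mul_ite, mul_one,
    mul_zero, Finset.sum_ite_eq]
  split_ifs with hk
  exacts [rfl, h k hk]

theorem toL2_fourier_mem_hardy {k : ℤ} (hk : 0 ≤ k) : toL2 (fourier k) ∈ hardy := by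
  intro l hl
  rw [fourierCoeff_toL2_fourier, if_neg (by omega)]

theorem mem_orthogonal_hardy_iff (f : L2Circle) :
    f ∈ hardyᗮ ↔ ∀ k : ℤ, 0 ≤ k → fourierCoeff f k = 0 := by
  constructor
  · intro hf k hk
    rw [← inner_toL2_fourier]
    exact hf _ (toL2_fourier_mem_hardy hk)
  · intro hf h hh
    rw [← (fourierBasis (T := 2 * π)).tsum_inner_mul_inner h f]
    refine (tsum_congr fun k => ?_).trans tsum_zero
    rw [← fourierCoeff_eq_inner, ← inner_conj_symm, ← fourierCoeff_eq_inner]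
    rcases lt_or_ge k 0 with hk | hk
    · rw [hh k hk, map_zero, zero_mul]
    · rw [hf k hk, mul_zero]

theorem toL2_star_zC_mul_mem_hardy_iff (ψ : C(CircleParam, ℂ)) :
    toL2 (star (zC * ψ)) ∈ hardy ↔ toL2 ψ ∈ hardyᗮ := by
  have coeff (k : ℤ) : fourierCoeff (toL2 (star (zC * ψ))) k =
      conj (fourierCoeff (toL2 ψ) (-k - 1)) := by
    rw [fourierCoeff_toL2_star, ← multiplication_toLp, fourierCoeff_mulL2_fourier]
  rw [mem_orthogonal_hardy_iff]
  constructor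
  · intro h k hk
    have := h (-k - 1) (by omega)
    rwa [coeff, map_eq_zero, show -(-k - 1) - 1 = k by ring] at this
  · intro h k hk
    rw [coeff, h _ (by omega), map_zero]

/-- The algebra of continuous functions that multiply the Hardy space into itself (the disk
algebra). -/
def hardyMultiplier : Subalgebra ℂ C(CircleParam, ℂ) where
  carrier := {φ | ∀ f ∈ hardy, mulL2 φ f ∈ hardy}
  mul_mem' {φ ψ} hφ hψ f hf := by
    rw [multiplication_mul_apply]
    exact hφ _ (hψ f hf)
  add_mem' {φ ψ} hφ hψ f hf := by
    rw [map_add, add_apply]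
    exact add_mem (hφ f hf) (hψ f hf)
  algebraMap_mem' r f hf := by
    rw [AlgHomClass.commutes, Algebra.algebraMap_eq_smul_one]
    exact hardy.smul_mem r hf

theorem isClosed_hardyMultiplier : IsClosed (hardyMultiplier : Set C(CircleParam, ℂ)) := by
  have heq : (hardyMultiplier : Set C(CircleParam, ℂ)) =
      ⋂ f ∈ hardy, (fun φ => mulL2 φ f) ⁻¹' (hardy : Set L2Circle) := by
    ext φ
    simp only [Set.mem_iInter]
    rfl
  rw [heq]
  refine isClosed_biInter fun f _ => isClosed_hardy.preimage ?_
  exact (ContinuousLinearMap.apply ℂ L2Circle f).continuous.comp (continuous_multiplication _)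

theorem inverse_one_sub_mem {A : Type*} [NormedRing A] [NormedAlgebra ℂ A] [CompleteSpace A]
    {S : Subalgebra ℂ A} (hS : IsClosed (S : Set A)) {x : A} (hx : x ∈ S) (hnorm : ‖x‖ < 1) :
    Ring.inverse (1 - x) ∈ S := by
  rw [NormedRing.inverse_one_sub x hnorm]
  exact hS.mem_of_tendsto (summable_geometric_of_norm_lt_one hnorm).hasSum
    (Filter.Eventually.of_forall fun s => S.sum_mem fun k _ => S.pow_mem hx k)

theorem zC_mem_hardyMultiplier : zC ∈ hardyMultiplier := by
  intro f hf k hk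
  rw [fourierCoeff_mulL2_fourier]
  exact hf _ (by omega)

theorem toL2_mem_hardy {φ : C(CircleParam, ℂ)} (hφ : φ ∈ hardyMultiplier) : toL2 φ ∈ hardy := by
  have h := hφ _ (toL2_fourier_mem_hardy le_rfl)
  rwa [multiplication_toLp, fourier_zero_eq_one, mul_one] at h

theorem mulL2_star_mem_orthogonal_hardy {φ : C(CircleParam, ℂ)} (hφ : φ ∈ hardyMultiplier)
    {f : L2Circle} (hf : f ∈ hardyᗮ) : mulL2 (star φ) f ∈ hardyᗮ := by
  intro h hh
  rw [inner_multiplication_right, star_star]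
  exact hf _ (hφ h hh)

end Hardy

section Blaschke

/-- A representation of `α` on the closed unit disk as a finite Blaschke product of degree `m`,
with unimodular constant `c` and zeros `a j`. -/
structure BlaschkeFactorization (α : ℂ → ℂ) (m : ℕ) where
  c : ℂ
  a : Fin m → ℂ
  norm_c : ‖c‖ = 1
  norm_a (j : Fin m) : ‖a j‖ < 1
  eq_prod (z : ℂ) : ‖z‖ ≤ 1 → α z = c * ∏ j, (z - a j) / (1 - conj (a j) * z)

theorem IsFiniteBlaschkeProduct.nonempty_factorization {α : ℂ → ℂ} {m : ℕ}
    (hα : IsFiniteBlaschkeProduct α m) : Nonempty (BlaschkeFactorization α m) :=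
  let ⟨c, a, hc, ha, h⟩ := hα
  ⟨⟨c, a, hc, ha, h⟩⟩

theorem norm_conj_smul_zC_lt_one {a : ℂ} (ha : ‖a‖ < 1) : ‖conj a • zC‖ < 1 := by
  rwa [norm_smul, fourier_norm, mul_one, RCLike.norm_conj]

theorem one_sub_smul_mem_hardyMultiplier (w : ℂ) : 1 - w • zC ∈ hardyMultiplier :=
  sub_mem (one_mem _) (hardyMultiplier.smul_mem zC_mem_hardyMultiplier w)

theorem zC_sub_smul_one (w : ℂ) : zC - w • 1 = zC * star (1 - conj w • zC) := by
  rw [star_sub, star_one, star_smul, RCLike.star_def, Complex.conj_conj, mul_sub, mul_one,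
    mul_smul_comm, mul_comm zC, star_zC_mul_zC]

namespace BlaschkeFactorization

variable {α : ℂ → ℂ} {m : ℕ} (B : BlaschkeFactorization α m)

/-- The denominator of the Blaschke product, as a function on the circle. -/
def den : C(CircleParam, ℂ) := ∏ j, (1 - conj (B.a j) • zC)

/-- The reciprocal of `den`. -/
def denInv : C(CircleParam, ℂ) := ∏ j, Ring.inverse (1 - conj (B.a j) • zC)

/-- The Blaschke product, as a function on the circle. -/
def boundary : C(CircleParam, ℂ) := B.c • ((∏ j, (zC - B.a j • 1)) * B.denInv)

theorem den_mul_denInv : B.den * B.denInv = 1 := by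
  rw [den, denInv, ← Finset.prod_mul_distrib]
  exact Finset.prod_eq_one fun j _ => Ring.mul_inverse_cancel _
    (isUnit_one_sub_of_norm_lt_one (norm_conj_smul_zC_lt_one (B.norm_a j)))

theorem star_den_mul_star_denInv : star B.den * star B.denInv = 1 := by
  rw [← star_mul', den_mul_denInv, star_one]

theorem denInv_mem_hardyMultiplier : B.denInv ∈ hardyMultiplier :=
  prod_mem fun j _ => inverse_one_sub_mem isClosed_hardyMultiplier
    (hardyMultiplier.smul_mem zC_mem_hardyMultiplier _) (norm_conj_smul_zC_lt_one (B.norm_a j))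

theorem boundary_eq : B.boundary = B.c • (zC ^ m * star B.den * B.denInv) := by
  rw [boundary, den, star_prod, ← Fin.prod_const, ← Finset.prod_mul_distrib]
  simp only [zC_sub_smul_one]

theorem boundary_apply (t : CircleParam) : B.boundary t = α (circlePt t) := by
  have hinv : B.denInv t = (B.den t)⁻¹ :=
    eq_inv_of_mul_eq_one_right (DFunLike.congr_fun B.den_mul_denInv t)
  rw [B.eq_prod _ (norm_circlePt t).le, boundary, ContinuousMap.smul_apply,
    ContinuousMap.mul_apply, hinv, Finset.prod_div_distrib, div_eq_mul_inv, smul_eq_mul]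
  simp [den, circlePt]

theorem star_boundary_mul_boundary : star B.boundary * B.boundary = 1 := by
  have hc : conj B.c * B.c = 1 := by
    rw [mul_comm, Complex.mul_conj, Complex.normSq_eq_norm_sq, B.norm_c]
    simp
  rw [boundary_eq, star_smul, star_mul', star_mul', star_star, smul_mul_smul_comm, RCLike.star_def,
    hc, one_smul]
  calc star (zC ^ m) * B.den * star B.denInv * (zC ^ m * star B.den * B.denInv)
    _ = (star (zC ^ m) * zC ^ m) * (B.den * B.denInv) * (star B.den * star B.denInv) := by ring
    _ = 1 := by rw [star_zC_pow_mul, den_mul_denInv, star_den_mul_star_denInv, one_mul, one_mul]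

theorem mem_model_iff (f : L2Circle) :
    f ∈ model α ↔ f ∈ hardy ∧ mulL2 (star B.boundary) f ∈ hardyᗮ := by
  have mulHardy_eq : mulHardy α = hardy.map (mulL2 B.boundary).toLinearMap := by
    ext g
    refine exists_congr fun h => and_congr_right fun _ => ?_
    have heq := coeFn_multiplication haarAddCircle B.boundary h
    simp only [boundary_apply] at heq
    exact ⟨fun hg => Lp.ext (heq.trans (Filter.EventuallyEq.symm hg)), fun hg => hg ▸ heq⟩
  rw [model, Submodule.mem_inf, mulHardy_eq]
  refine and_congr_right fun _ => ?_
  simp only [Submodule.mem_orthogonal, Submodule.mem_map, forall_exists_index, and_imp,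
    forall_apply_eq_imp_iff₂, inner_multiplication_right, star_star]
  rfl

theorem toL2_conj_mem_model {φ : C(CircleParam, ℂ)} (hφ : toL2 φ ∈ model α) :
    toL2 (B.boundary * star (zC * φ)) ∈ model α := by
  rw [mem_model_iff, multiplication_toLp] at hφ ⊢
  constructor
  · have h := (toL2_star_zC_mul_mem_hardy_iff _).mpr hφ.2
    rwa [mul_left_comm, star_mul', star_star] at h
  · rw [← mul_assoc, star_boundary_mul_boundary, one_mul, ← toL2_star_zC_mul_mem_hardy_iff]
    rw [star_mul', star_star, ← mul_assoc, star_zC_mul_zC, one_mul]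
    exact hφ.1

/-- The functions `z ^ i / ∏ (1 - conj (a j) z)`, `i < m`, a basis of the model space. -/
def basisFun (i : ℕ) : C(CircleParam, ℂ) := zC ^ i * B.denInv

theorem star_basisFun_mul_boundary {i : ℕ} (hi : i ≤ m) :
    star (B.basisFun i) * B.boundary = B.c • B.basisFun (m - i) := by
  rw [basisFun, basisFun, boundary_eq, star_mul', mul_smul_comm]
  congr 1
  calc star (zC ^ i) * star B.denInv * (zC ^ m * star B.den * B.denInv)
    _ = (star (zC ^ i) * zC ^ i) * (star B.den * star B.denInv) * (zC ^ (m - i) * B.denInv) := by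
        rw [← pow_mul_pow_sub zC hi]
        ring
    _ = zC ^ (m - i) * B.denInv := by
        rw [star_zC_pow_mul, star_den_mul_star_denInv, one_mul, one_mul]

theorem toL2_basisFun_mem_hardy (i : ℕ) : toL2 (B.basisFun i) ∈ hardy :=
  toL2_mem_hardy (mul_mem (pow_mem zC_mem_hardyMultiplier i) B.denInv_mem_hardyMultiplier)

theorem toL2_basisFun_mem_model {i : ℕ} (hi : i < m) : toL2 (B.basisFun i) ∈ model α := by
  have conj_eq : star (zC * (star B.boundary * B.basisFun i)) = B.c • B.basisFun (m - (i + 1)) := by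
    rw [← B.star_basisFun_mul_boundary hi, basisFun, basisFun, pow_succ]
    simp only [star_mul', star_star]
    ring
  rw [mem_model_iff, multiplication_toLp, ← toL2_star_zC_mul_mem_hardy_iff, conj_eq, map_smul]
  exact ⟨B.toL2_basisFun_mem_hardy i, hardy.smul_mem _ (B.toL2_basisFun_mem_hardy _)⟩

theorem fourierCoeff_mulL2_den_eq_zero {f : L2Circle} (hf : f ∈ model α) {k : ℤ}
    (hk : k < 0 ∨ m ≤ k) : fourierCoeff (mulL2 B.den f) k = 0 := by
  obtain ⟨hardy_f, orthogonal_f⟩ := (B.mem_model_iff f).mp hf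
  have den_mem : B.den ∈ hardyMultiplier :=
    prod_mem fun j _ => one_sub_smul_mem_hardyMultiplier _
  rcases hk with hk | hk
  · exact den_mem f hardy_f k hk
  · have den_eq : B.den = zC ^ m * (star B.den * (star B.boundary * B.c • 1)) := by
      calc B.den
        _ = star B.boundary * B.boundary * B.den := by rw [star_boundary_mul_boundary, one_mul]
        _ = star B.boundary * (B.c • (zC ^ m * star B.den * (B.den * B.denInv))) := by
          rw [mul_assoc, boundary_eq, smul_mul_assoc, mul_assoc _ B.denInv, mul_comm B.denInv]
        _ = zC ^ m * (star B.den * (star B.boundary * B.c • 1)) := by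
          rw [den_mul_denInv, mul_one, mul_smul_comm, mul_smul_comm, mul_smul_comm, mul_smul_comm]
          congr 1
          ring
    rw [den_eq, multiplication_mul_apply, zC_pow, fourierCoeff_mulL2_fourier,
      multiplication_mul_apply, multiplication_mul_apply, map_smul, map_one]
    refine (mem_orthogonal_hardy_iff _).mp (mulL2_star_mem_orthogonal_hardy den_mem ?_) _ (by omega)
    rw [smul_apply, map_smul]
    exact Submodule.smul_mem _ _ orthogonal_f

theorem toL2_basisFun (i : ℕ) :
    toL2 (B.basisFun i) = mulL2 B.denInv (toL2 (fourier (i : ℤ))) := by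
  rw [basisFun, zC_pow, mul_comm (fourier _), multiplication_toLp]

theorem linearIndependent_basisFun :
    LinearIndependent ℂ fun i : Fin m => toL2 (B.basisFun i) := by
  simp only [toL2_basisFun]
  have fourier_independent : LinearIndependent ℂ fun i : Fin m => toL2 (fourier ((i : ℕ) : ℤ)) :=
    (orthonormal_fourier (T := 2 * π)).linearIndependent.comp _
      (Nat.cast_injective.comp Fin.val_injective)
  refine fourier_independent.map' (mulL2 B.denInv).toLinearMap (LinearMap.ker_eq_bot.mpr ?_)
  refine Function.LeftInverse.injective (g := mulL2 B.den) fun f => ?_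
  change mulL2 B.den (mulL2 B.denInv f) = f
  rw [← multiplication_mul_apply, den_mul_denInv, map_one, one_apply_eq_self]

theorem eq_sum_basisFun {f : L2Circle} (hf : f ∈ model α) :
    f = ∑ i : Fin m, fourierCoeff (mulL2 B.den f) (i : ℕ) • toL2 (B.basisFun i) := by
  have expand := eq_sum_of_fourierCoeff_eq_zero
    (Finset.univ.map ⟨fun i : Fin m => ((i : ℕ) : ℤ), Nat.cast_injective.comp Fin.val_injective⟩)
    fun k hk => B.fourierCoeff_mulL2_den_eq_zero hf (k := k) <| by
      by_contra! h
      refine hk (Finset.mem_map.mpr ⟨⟨k.toNat, by omega⟩, Finset.mem_univ _, ?_⟩)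
      exact Int.toNat_of_nonneg h.1
  calc f
    _ = mulL2 B.denInv (mulL2 B.den f) := by
      rw [← multiplication_mul_apply, mul_comm B.denInv, den_mul_denInv, map_one,
        one_apply_eq_self]
    _ = mulL2 B.denInv (∑ i : Fin m,
          fourierCoeff (mulL2 B.den f) (i : ℕ) • toL2 (fourier ((i : ℕ) : ℤ))) :=
      congrArg _ (expand.trans (Finset.sum_map ..))
    _ = _ := by simp only [map_sum, map_smul, toL2_basisFun]

/-- The functions `basisFun`, as a basis of the model space. -/
def basis : Module.Basis (Fin m) ℂ (model α) :=
  .mk (v := fun i : Fin m => ⟨toL2 (B.basisFun i), B.toL2_basisFun_mem_model i.isLt⟩)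
    (.of_comp (model α).subtype B.linearIndependent_basisFun) <| by
      rintro ⟨f, hf⟩ -
      rw [Submodule.mem_span_range_iff_exists_fun]
      refine ⟨fun i => fourierCoeff (mulL2 B.den f) (i : ℕ), Subtype.ext ?_⟩
      simpa using (B.eq_sum_basisFun hf).symm

theorem coe_basis (i : Fin m) : (B.basis i : L2Circle) = toL2 (B.basisFun i) := by
  rw [basis, Module.Basis.mk_apply]

/-- The basis `basis` in reverse order. With it as basis of the codomain, the matrices of truncated
Toeplitz operators become Hankel matrices. -/
def revBasis : Module.Basis (Fin m) ℂ (model α) := B.basis.reindex Fin.revPerm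

theorem revBasis_apply (i : Fin m) : B.revBasis i = B.basis i.rev := by
  rw [revBasis, Module.Basis.reindex_apply, Fin.revPerm_symm, Fin.revPerm_apply]

theorem boundary_ne_smul_one (hm : 0 < m) (r : ℂ) : B.boundary ≠ r • 1 := by
  intro hr
  set f := B.basis ⟨0, hm⟩
  obtain ⟨hardy_f, orthogonal_f⟩ := (B.mem_model_iff f).mp f.2
  have f_eq : (f : L2Circle) = r • mulL2 (star B.boundary) f := by
    calc (f : L2Circle)
      _ = mulL2 (B.boundary * star B.boundary) f := by
        rw [mul_comm B.boundary, star_boundary_mul_boundary, map_one, one_apply_eq_self]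
      _ = r • mulL2 (star B.boundary) f := by
        nth_rw 1 [hr]
        rw [smul_one_mul, map_smul]
        rfl
  have f_eq_zero : (f : L2Circle) = 0 :=
    hardy.orthogonal_disjoint.le_bot ⟨hardy_f, f_eq ▸ hardyᗮ.smul_mem r orthogonal_f⟩
  exact B.basis.ne_zero ⟨0, hm⟩ (Subtype.ext f_eq_zero)

section Numerator

open Polynomial

theorem toL2_aeval_mul_denInv_mem_model {q : ℂ[X]} (hq : q.natDegree < m) :
    toL2 (aeval zC q * B.denInv) ∈ model α := by
  rw [aeval_eq_sum_range' hq, Finset.sum_mul, map_sum]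
  refine sum_mem fun i hi => ?_
  rw [smul_mul_assoc, map_smul]
  exact (model α).smul_mem _ (B.toL2_basisFun_mem_model (Finset.mem_range.mp hi))

/-- The polynomial `(α - α w) ∏ (1 - conj (a j) z)`, divisible by `z - w`. -/
def numeratorSub (w : ℂ) : ℂ[X] :=
  C B.c * ∏ j, (X - C (B.a j)) - C (α w) * ∏ j, (1 - C (conj (B.a j)) * X)

theorem natDegree_numeratorSub_le (w : ℂ) : (B.numeratorSub w).natDegree ≤ m := by
  have bound (p : Fin m → ℂ[X]) (hp : ∀ j, (p j).natDegree ≤ 1) (r : ℂ) :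
      (C r * ∏ j, p j).natDegree ≤ m :=
    calc (C r * ∏ j, p j).natDegree
      _ ≤ (∏ j, p j).natDegree := natDegree_C_mul_le _ _
      _ ≤ ∑ j, (p j).natDegree := natDegree_prod_le _ _
      _ ≤ m := by simpa using Finset.sum_le_card_nsmul Finset.univ _ 1 fun j _ => hp j
  refine (natDegree_sub_le_of_le (bound _ (fun j => ?_) _) (bound _ (fun j => ?_) _)).trans
    (max_self m).le
  all_goals compute_degree

theorem isRoot_numeratorSub {w : ℂ} (hw : ‖w‖ ≤ 1) : (B.numeratorSub w).IsRoot w := by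
  have factor_ne_zero (j : Fin m) : 1 - conj (B.a j) * w ≠ 0 := by
    intro h
    have hnorm : ‖conj (B.a j) * w‖ = 1 := by rw [← sub_eq_zero.mp h, norm_one]
    rw [norm_mul, RCLike.norm_conj] at hnorm
    nlinarith [B.norm_a j, norm_nonneg (B.a j), norm_nonneg w]
  have hprod : ∏ j, (1 - conj (B.a j) * w) ≠ 0 :=
    Finset.prod_ne_zero_iff.mpr fun j _ => factor_ne_zero j
  simp only [IsRoot, numeratorSub, eval_sub, eval_mul, eval_prod, eval_C, eval_X, eval_one]
  rw [B.eq_prod w hw, Finset.prod_div_distrib, mul_assoc, div_mul_cancel₀ _ hprod, sub_self]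

theorem aeval_numeratorSub_mul_denInv (w : ℂ) :
    aeval zC (B.numeratorSub w) * B.denInv = B.boundary - α w • 1 := by
  simp only [numeratorSub, map_sub, map_mul, map_prod, aeval_C, aeval_X, map_one,
    Algebra.algebraMap_eq_smul_one, smul_one_mul]
  rw [← den, sub_mul, smul_mul_assoc, smul_mul_assoc, den_mul_denInv, boundary]

theorem exists_conj_kernel (hm : 0 < m) {w : ℂ} (hw : ‖w‖ ≤ 1) :
    ∃ φ : C(CircleParam, ℂ), toL2 φ ∈ model α ∧ (zC - w • 1) * φ = B.boundary - α w • 1 := by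
  have division := mul_divByMonic_eq_iff_isRoot.mpr (B.isRoot_numeratorSub hw)
  refine ⟨aeval zC (B.numeratorSub w /ₘ (X - C w)) * B.denInv,
    B.toL2_aeval_mul_denInv_mem_model ?_, ?_⟩
  · rw [natDegree_divByMonic _ (monic_X_sub_C w), natDegree_X_sub_C]
    have := B.natDegree_numeratorSub_le w
    omega
  · have linear : zC - w • 1 = aeval zC (X - C w) := by
      rw [map_sub, aeval_X, aeval_C, Algebra.algebraMap_eq_smul_one]
    rw [linear, ← mul_assoc, ← map_mul, division, aeval_numeratorSub_mul_denInv]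

end Numerator

theorem exists_kernel (hm : 0 < m) {w : ℂ} (hw : ‖w‖ ≤ 1) :
    ∃ φ : C(CircleParam, ℂ), toL2 φ ∈ model α ∧
      (1 - conj w • zC) * φ = 1 - conj (α w) • B.boundary := by
  obtain ⟨φ, hφ, h⟩ := B.exists_conj_kernel hm hw
  refine ⟨B.boundary * star (zC * φ), B.toL2_conj_mem_model hφ, ?_⟩
  have linear : 1 - conj w • zC = zC * star (zC - w • 1) := by
    rw [star_sub, star_smul, star_one, mul_sub, mul_comm zC, star_zC_mul_zC, mul_smul_comm, mul_one]
    rfl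
  calc (1 - conj w • zC) * (B.boundary * star (zC * φ))
    _ = (star zC * zC) * (B.boundary * star ((zC - w • 1) * φ)) := by
      rw [linear, star_mul', star_mul']
      ring
    _ = star B.boundary * B.boundary - conj (α w) • B.boundary := by
      rw [star_zC_mul_zC, one_mul, h, star_sub, star_smul, star_one, mul_sub, mul_smul_comm,
        mul_one, mul_comm B.boundary]
      rfl
    _ = 1 - conj (α w) • B.boundary := by rw [star_boundary_mul_boundary]

theorem isKernel_iff (w : ℂ) (f : model α) :
    IsKernel α w f ↔ mulL2 (1 - conj w • zC) f = toL2 (1 - conj (α w) • B.boundary) := by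
  have denominator_ne_zero : ∀ᵐ t ∂(haarAddCircle : Measure CircleParam),
      (1 - conj w • zC : C(CircleParam, ℂ)) t ≠ 0 := by
    filter_upwards [ae_circlePt_ne (conj w)⁻¹] with t ht h
    exact ht (eq_inv_of_mul_eq_one_right (sub_eq_zero.mp (by simpa [circlePt] using h)).symm)
  rw [multiplication_eq_toLp_iff _ denominator_ne_zero]
  simp [IsKernel, Filter.EventuallyEq, boundary_apply, circlePt]

theorem isConjKernel_iff (w : ℂ) (f : model α) :
    IsConjKernel α w f ↔ mulL2 (zC - w • 1) f = toL2 (B.boundary - α w • 1) := by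
  have denominator_ne_zero : ∀ᵐ t ∂(haarAddCircle : Measure CircleParam),
      (zC - w • 1 : C(CircleParam, ℂ)) t ≠ 0 := by
    filter_upwards [ae_circlePt_ne w] with t ht h
    exact ht (by simpa [circlePt, sub_eq_zero] using h)
  rw [multiplication_eq_toLp_iff _ denominator_ne_zero]
  simp [IsConjKernel, Filter.EventuallyEq, boundary_apply, circlePt]

theorem exists_isConjKernel (B : BlaschkeFactorization α m) (hm : 0 < m) {w : ℂ} (hw : ‖w‖ ≤ 1) :
    ∃ f : model α, IsConjKernel α w f := by
  obtain ⟨φ, hφ, h⟩ := B.exists_conj_kernel hm hw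
  exact ⟨⟨toL2 φ, hφ⟩, (B.isConjKernel_iff w _).mpr (by rw [multiplication_toLp, h])⟩

theorem exists_isKernel (B : BlaschkeFactorization α m) (hm : 0 < m) {w : ℂ} (hw : ‖w‖ ≤ 1) :
    ∃ f : model α, IsKernel α w f := by
  obtain ⟨φ, hφ, h⟩ := B.exists_kernel hm hw
  exact ⟨⟨toL2 φ, hφ⟩, (B.isKernel_iff w _).mpr (by rw [multiplication_toLp, h])⟩

theorem ne_zero_of_isConjKernel (B : BlaschkeFactorization α m) (hm : 0 < m) {w : ℂ} {f : model α}
    (hf : IsConjKernel α w f) :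
    f ≠ 0 := by
  rintro rfl
  rw [B.isConjKernel_iff, ZeroMemClass.coe_zero, map_zero, ← map_zero toL2] at hf
  exact B.boundary_ne_smul_one hm _
    (sub_eq_zero.mp (ContinuousMap.toLp_injective haarAddCircle hf).symm)

theorem ne_zero_of_isKernel (B : BlaschkeFactorization α m) (hm : 0 < m) {w : ℂ} {f : model α}
    (hf : IsKernel α w f) :
    f ≠ 0 := by
  rintro rfl
  rw [B.isKernel_iff, ZeroMemClass.coe_zero, map_zero, ← map_zero toL2] at hf
  have one_eq : 1 = conj (α w) • B.boundary :=
    sub_eq_zero.mp (ContinuousMap.toLp_injective haarAddCircle hf).symm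
  refine B.boundary_ne_smul_one hm (α w) ?_
  calc B.boundary
    _ = B.boundary * star (conj (α w) • B.boundary) := by rw [← one_eq, star_one, mul_one]
    _ = α w • 1 := by
      rw [star_smul, mul_smul_comm, mul_comm B.boundary, star_boundary_mul_boundary]
      simp

theorem inner_toL2_boundary_basisFun {i : ℕ} (hi : i < m) :
    inner ℂ (toL2 B.boundary) (toL2 (B.basisFun i)) = 0 := by
  have orthogonal := ((B.mem_model_iff _).mp (B.toL2_basisFun_mem_model hi)).2
  rw [mem_orthogonal_hardy_iff] at orthogonal
  rw [← orthogonal 0 le_rfl, ← inner_toL2_fourier, inner_multiplication_right, star_star,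
    multiplication_toLp, fourier_zero_eq_one, mul_one]

theorem inner_toL2_one_basisFun_succ (i : ℕ) :
    inner ℂ (toL2 1) (toL2 (B.basisFun (i + 1))) = 0 := by
  have shift : toL2 (B.basisFun (i + 1)) = mulL2 zC (toL2 (B.basisFun i)) := by
    rw [multiplication_toLp, basisFun, basisFun, pow_succ', mul_assoc]
  rw [← fourier_zero_eq_one, inner_toL2_fourier, shift,
    fourierCoeff_mulL2_fourier]
  exact B.toL2_basisFun_mem_hardy i _ (by norm_num)

theorem inner_basisFun_succ_of_isKernel {w : ℂ} {f : model α} (hf : IsKernel α w f) {i : ℕ}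
    (hi : i + 1 < m) :
    inner ℂ (f : L2Circle) (toL2 (B.basisFun (i + 1))) =
      w * inner ℂ (f : L2Circle) (toL2 (B.basisFun i)) := by
  have shift : toL2 (B.basisFun (i + 1)) - w • toL2 (B.basisFun i) =
      mulL2 (star (1 - conj w • zC)) (toL2 (B.basisFun (i + 1))) := by
    rw [multiplication_toLp, ← map_smul, ← map_sub, basisFun, basisFun, pow_succ', mul_assoc zC,
      ← mul_assoc (star _), mul_comm (star _), ← zC_sub_smul_one, sub_mul, smul_one_mul]
  rw [← sub_eq_zero, ← inner_smul_right, ← inner_sub_right, shift, inner_multiplication_right,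
    star_star, (B.isKernel_iff w f).mp hf, map_sub, map_smul, inner_sub_left, inner_smul_left,
    inner_toL2_one_basisFun_succ, B.inner_toL2_boundary_basisFun hi, mul_zero, sub_zero]

theorem inner_basisFun_of_isConjKernel {w : ℂ} {g : model α} (hg : IsConjKernel α w g) {i : ℕ}
    (hi : i + 1 < m) :
    inner ℂ (toL2 (B.basisFun i)) (g : L2Circle) =
      w * inner ℂ (toL2 (B.basisFun (i + 1))) (g : L2Circle) := by
  have shift : inner ℂ (toL2 (B.basisFun i)) (g : L2Circle) =
      inner ℂ (toL2 (B.basisFun (i + 1))) (mulL2 zC g) := by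
    rw [inner_multiplication_right, multiplication_toLp, basisFun, basisFun, pow_succ',
      mul_assoc zC, ← mul_assoc (star zC), star_zC_mul_zC, one_mul]
  have vanish : inner ℂ (toL2 (B.basisFun (i + 1))) (mulL2 (zC - w • 1) g) = 0 := by
    rw [(B.isConjKernel_iff w g).mp hg, ← inner_conj_symm, map_sub, map_smul, inner_sub_left,
      inner_smul_left, inner_toL2_one_basisFun_succ, B.inner_toL2_boundary_basisFun hi, mul_zero,
      sub_zero, map_zero]
  rw [shift, ← sub_eq_zero, ← inner_smul_right, ← inner_sub_right, ← vanish, map_sub, map_smul,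
    map_one]
  rfl

theorem inner_basis_of_isKernel (hm : 0 < m) {w : ℂ} {f : model α} (hf : IsKernel α w f) :
    ∃ C ≠ 0, ∀ i : Fin m, inner ℂ f (B.basis i) = C * w ^ (i : ℕ) := by
  have geometric (i : ℕ) (hi : i < m) : inner ℂ (f : L2Circle) (toL2 (B.basisFun i)) =
      inner ℂ (f : L2Circle) (toL2 (B.basisFun 0)) * w ^ i := by
    induction i with
    | zero => rw [pow_zero, mul_one]
    | succ i ih =>
      rw [B.inner_basisFun_succ_of_isKernel hf hi, ih (by omega), pow_succ', mul_left_comm]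
  refine ⟨inner ℂ (f : L2Circle) (toL2 (B.basisFun 0)), fun h0 => ?_, fun i => ?_⟩
  · refine B.ne_zero_of_isKernel hm hf (InnerProductSpace.ext_inner_right_basis B.basis fun i => ?_)
    rw [Submodule.coe_inner, coe_basis, geometric i i.isLt, h0, zero_mul, inner_zero_left]
  · rw [Submodule.coe_inner, coe_basis, geometric i i.isLt]

theorem inner_revBasis_of_isConjKernel (hm : 0 < m) {w : ℂ} {g : model α}
    (hg : IsConjKernel α w g) :
    ∃ C ≠ 0, ∀ i : Fin m, inner ℂ (B.revBasis i) g = C * w ^ (i : ℕ) := by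
  have geometric (i : ℕ) (hi : i < m) :
      inner ℂ (toL2 (B.basisFun (m - (i + 1)))) (g : L2Circle) =
        inner ℂ (toL2 (B.basisFun (m - 1))) (g : L2Circle) * w ^ i := by
    induction i with
    | zero => rw [pow_zero, mul_one]
    | succ i ih =>
      rw [B.inner_basisFun_of_isConjKernel hg (by omega),
        show m - (i + 1 + 1) + 1 = m - (i + 1) by omega, ih (by omega), pow_succ', mul_left_comm]
  refine ⟨inner ℂ (toL2 (B.basisFun (m - 1))) (g : L2Circle), fun h0 => ?_, fun i => ?_⟩
  · refine B.ne_zero_of_isConjKernel hm hg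
      (InnerProductSpace.ext_inner_left_basis B.revBasis fun i => ?_)
    rw [Submodule.coe_inner, revBasis_apply, coe_basis, Fin.val_rev, geometric i i.isLt, h0,
      zero_mul, inner_zero_right]
  · rw [Submodule.coe_inner, revBasis_apply, coe_basis, Fin.val_rev, geometric i i.isLt]

variable {β : ℂ → ℂ} {n : ℕ} (B' : BlaschkeFactorization β n)

theorem inner_basis_of_isConjKernel (hm : 0 < m) {w : ℂ} {f : model α}
    (hf : IsConjKernel α w f) :
    ∃ C ≠ 0, ∀ i : Fin m, inner ℂ f (B.basis i) = C * conj w ^ (m - 1 - i : ℕ) := by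
  obtain ⟨C, hC, h⟩ := B.inner_revBasis_of_isConjKernel hm hf
  refine ⟨conj C, (map_ne_zero _).mpr hC, fun i => ?_⟩
  calc inner ℂ f (B.basis i)
    _ = conj (inner ℂ (B.revBasis i.rev) f) := by
      rw [revBasis_apply, Fin.rev_rev]
      exact (inner_conj_symm f _).symm
    _ = conj C * conj w ^ (m - 1 - i : ℕ) := by
      rw [h, map_mul, map_pow, Fin.val_rev, Nat.add_comm, Nat.sub_add_eq]

theorem inner_revBasis_of_isKernel (hm : 0 < m) {w : ℂ} {g : model α} (hg : IsKernel α w g) :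
    ∃ C ≠ 0, ∀ j : Fin m, inner ℂ (B.revBasis j) g = C * conj w ^ (m - 1 - j : ℕ) := by
  obtain ⟨C, hC, h⟩ := B.inner_basis_of_isKernel hm hg
  refine ⟨conj C, (map_ne_zero _).mpr hC, fun j => ?_⟩
  calc inner ℂ (B.revBasis j) g
    _ = conj (inner ℂ g (B.basis j.rev)) := by
      rw [revBasis_apply]
      exact (inner_conj_symm _ g).symm
    _ = conj C * conj w ^ (m - 1 - j : ℕ) := by
      rw [h, map_mul, map_pow, Fin.val_rev, Nat.add_comm, Nat.sub_add_eq]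

theorem gram_rankOne_conjKernel_kernel (hm : 0 < m) (hn : 0 < n) {w : ℂ} {f : model α}
    {g : model β} (hf : IsKernel α w f) (hg : IsConjKernel β w g) :
    ∃ C ≠ 0, gram B.basis B'.revBasis (InnerProductSpace.rankOne ℂ g f) =
      hankel m n fun k => C * w ^ k := by
  obtain ⟨C, hC, hf⟩ := B.inner_basis_of_isKernel hm hf
  obtain ⟨C', hC', hg⟩ := B'.inner_revBasis_of_isConjKernel hn hg
  refine ⟨C * C', mul_ne_zero hC hC', ?_⟩
  ext i j
  rw [gram_rankOne, Matrix.vecMulVec_apply, hf, hg, mul_mul_mul_comm, ← pow_add]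
  rfl

theorem gram_rankOne_kernel_conjKernel (hm : 0 < m) (hn : 0 < n) {w : ℂ} {f : model α}
    {g : model β} (hf : IsConjKernel α w f) (hg : IsKernel β w g) :
    ∃ C ≠ 0, gram B.basis B'.revBasis (InnerProductSpace.rankOne ℂ g f) =
      hankel m n fun k => C * conj w ^ (m + n - 2 - k) := by
  obtain ⟨C, hC, hf⟩ := B.inner_basis_of_isConjKernel hm hf
  obtain ⟨C', hC', hg⟩ := B'.inner_revBasis_of_isKernel hn hg
  refine ⟨C * C', mul_ne_zero hC hC', ?_⟩
  ext i j
  rw [gram_rankOne, Matrix.vecMulVec_apply, hf, hg, mul_mul_mul_comm, ← pow_add,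
    show m - 1 - i + (n - 1 - j) = m + n - 2 - (i + j) by omega]
  rfl

theorem mem_kernelTensors_iff (hm : 0 < m) (hn : 0 < n) (A : model α →L[ℂ] model β) :
    A ∈ kernelTensors α β ↔
      ∃ l, OnRationalNormalCurve (m + n - 2) l ∧ gram B.basis B'.revBasis A = hankel m n l := by
  constructor
  · rintro ⟨w, -, c, hc, f, g, ⟨hg, hf⟩ | ⟨hg, hf⟩, rfl⟩
    · obtain ⟨C, hC, h⟩ := B.gram_rankOne_conjKernel_kernel B' hm hn hf hg
      exact ⟨_, (onRationalNormalCurve_geometric hC w _).smul hc, by rw [gram_smul, h, smul_hankel]⟩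
    · obtain ⟨C, hC, h⟩ := B.gram_rankOne_kernel_conjKernel B' hm hn hf hg
      exact ⟨_, (onRationalNormalCurve_geometric_rev hC _ _).smul hc,
        by rw [gram_smul, h, smul_hankel]⟩
  · rintro ⟨l, hl, hA⟩
    obtain ⟨w, hw, C, hC, h | h⟩ := hl.exists_norm_le_one
    · obtain ⟨f, hf⟩ := B.exists_isKernel hm hw
      obtain ⟨g, hg⟩ := B'.exists_isConjKernel hn hw
      obtain ⟨C', hC', hfg⟩ := B.gram_rankOne_conjKernel_kernel B' hm hn hf hg
      refine ⟨w, hw, C / C', div_ne_zero hC hC', f, g, Or.inl ⟨hg, hf⟩,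
        gram_injective B.basis B'.revBasis ?_⟩
      rw [hA, gram_smul, hfg, smul_hankel]
      refine hankel_congr fun k hk => ?_
      rw [h k hk, Pi.smul_apply, smul_eq_mul, ← mul_assoc, div_mul_cancel₀ C hC']
    · have hw' : ‖conj w‖ ≤ 1 := by rwa [RCLike.norm_conj]
      obtain ⟨f, hf⟩ := B.exists_isConjKernel hm hw'
      obtain ⟨g, hg⟩ := B'.exists_isKernel hn hw'
      obtain ⟨C', hC', hfg⟩ := B.gram_rankOne_kernel_conjKernel B' hm hn hf hg
      refine ⟨conj w, hw', C / C', div_ne_zero hC hC', f, g, Or.inr ⟨hg, hf⟩,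
        gram_injective B.basis B'.revBasis ?_⟩
      rw [hA, gram_smul, hfg, smul_hankel]
      refine hankel_congr fun k hk => ?_
      rw [h k hk, Pi.smul_apply, smul_eq_mul, Complex.conj_conj, ← mul_assoc,
        div_mul_cancel₀ C hC']

/-- The common factor of the products of the basis functions of `model α` with the conjugates of
those of `model β`: all of them are powers of `z` times this function, see
`star_basisFun_rev_mul_basisFun`. -/
def weight : C(CircleParam, ℂ) := star (zC ^ (n - 1)) * star B'.denInv * B.denInv

/-- The reciprocal of `weight`. -/
def weightInv : C(CircleParam, ℂ) := zC ^ (n - 1) * star B'.den * B.den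

theorem weight_mul_weightInv : B.weight B' * B.weightInv B' = 1 := by
  calc B.weight B' * B.weightInv B'
    _ = (star (zC ^ (n - 1)) * zC ^ (n - 1)) * (star B'.den * star B'.denInv) *
        (B.den * B.denInv) := by
      rw [weight, weightInv]
      ring
    _ = 1 := by rw [star_zC_pow_mul, star_den_mul_star_denInv, den_mul_denInv, one_mul, one_mul]

theorem star_basisFun_rev_mul_basisFun (i : Fin m) (j : Fin n) :
    star (B'.basisFun j.rev) * B.basisFun i = zC ^ (i + j : ℕ) * B.weight B' := by
  have split : zC ^ (n - 1) = zC ^ (j.rev : ℕ) * zC ^ (j : ℕ) := by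
    rw [← pow_add, Fin.val_rev]
    congr 1
    omega
  rw [basisFun, basisFun, weight, split, star_mul', star_mul', pow_add]
  calc star (zC ^ (j.rev : ℕ)) * star B'.denInv * (zC ^ (i : ℕ) * B.denInv)
    _ = (star (zC ^ (j : ℕ)) * zC ^ (j : ℕ)) * (star (zC ^ (j.rev : ℕ)) * star B'.denInv *
        (zC ^ (i : ℕ) * B.denInv)) := by rw [star_zC_pow_mul, one_mul]
    _ = _ := by ring

theorem gram_eq_hankel_of_symbol {A : model α →L[ℂ] model β} {φ : L2Circle}
    (hA : ∀ i : Fin m, A (B.basis i) =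
      (model β).orthogonalProjectionOnto (mulL2 (B.basisFun i) φ)) :
    gram B.basis B'.revBasis A =
      hankel m n fun k => inner ℂ (toL2 1) (mulL2 (zC ^ k * B.weight B') φ) := by
  ext i j
  calc inner ℂ (B'.revBasis j) (A (B.basis i))
    _ = inner ℂ (toL2 (B'.basisFun j.rev)) (mulL2 (B.basisFun i) φ) := by
      rw [hA, Submodule.inner_orthogonalProjectionOnto_eq_of_mem_left, revBasis_apply, coe_basis]
    _ = inner ℂ (toL2 1) (mulL2 (star (B'.basisFun j.rev) * B.basisFun i) φ) := by
      rw [multiplication_mul_apply, inner_multiplication_right (f := toL2 1), star_star,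
        multiplication_toLp, mul_one]
    _ = inner ℂ (toL2 1) (mulL2 (zC ^ (i + j : ℕ) * B.weight B') φ) := by
      rw [star_basisFun_rev_mul_basisFun]

theorem exists_mem_asymTruncToeplitz_gram_eq_hankel (l : ℕ → ℂ) :
    ∃ A ∈ asymTruncToeplitz α β, gram B.basis B'.revBasis A = hankel m n l := by
  set ψ : C(CircleParam, ℂ) :=
    B.weightInv B' * ∑ k ∈ Finset.range (m + n - 2 + 1), l k • fourier (-k : ℤ) with hψ
  refine ⟨(model β).orthogonalProjectionOnto ∘L mulL2 ψ ∘L (model α).subtypeL,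
    ⟨toL2 ψ, fun f _ => ⟨mulL2 ψ f, ?_, rfl⟩⟩, ?_⟩
  · filter_upwards [coeFn_multiplication haarAddCircle ψ f,
      ContinuousMap.coeFn_toLp (p := 2) (𝕜 := ℂ) haarAddCircle ψ] with t hmul hψt
    rw [hmul, hψt]
  · rw [B.gram_eq_hankel_of_symbol B' (φ := toL2 ψ)]
    · refine hankel_congr fun k hk => ?_
      have cancel : zC ^ k * B.weight B' * ψ =
          ∑ r ∈ Finset.range (m + n - 2 + 1), l r • fourier (k - r : ℤ) := by
        calc zC ^ k * B.weight B' * ψ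
          _ = (B.weight B' * B.weightInv B') *
              (zC ^ k * ∑ r ∈ Finset.range (m + n - 2 + 1), l r • fourier (-r : ℤ)) := by
            rw [hψ]
            ring
          _ = ∑ r ∈ Finset.range (m + n - 2 + 1), l r • fourier (k - r : ℤ) := by
            rw [weight_mul_weightInv, one_mul, Finset.mul_sum]
            simp only [zC_pow, mul_smul_comm, fourier_mul_fourier, sub_eq_add_neg]
      rw [multiplication_toLp, cancel, ← fourier_zero_eq_one,
        map_sum, inner_sum, Finset.sum_eq_single_of_mem k (Finset.mem_range_succ_iff.mpr hk)]
      · rw [map_smul, inner_smul_right, inner_toL2_fourier, fourierCoeff_toL2_fourier, sub_self,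
          if_pos rfl, mul_one]
      · intro r _ hr
        rw [map_smul, inner_smul_right, inner_toL2_fourier, fourierCoeff_toL2_fourier,
          if_neg (by omega), mul_zero]
    · intro i
      rw [multiplication_toLp, mul_comm (B.basisFun i), ← multiplication_toLp, ← coe_basis]
      rfl

theorem mem_asymTruncToeplitz_iff (A : model α →L[ℂ] model β) :
    A ∈ asymTruncToeplitz α β ↔ ∃ l, gram B.basis B'.revBasis A = hankel m n l := by
  constructor
  · rintro ⟨φ, hφ⟩
    refine ⟨_, B.gram_eq_hankel_of_symbol B' (φ := φ) fun i => ?_⟩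
    have basis_ae : (B.basis i : L2Circle) =ᵐ[haarAddCircle] B.basisFun i := by
      rw [coe_basis]
      exact ContinuousMap.coeFn_toLp (p := 2) (𝕜 := ℂ) haarAddCircle _
    have bounded : MemLp (B.basis i : L2Circle) ⊤ haarAddCircle :=
      (ContinuousMap.memLp haarAddCircle ℂ (B.basisFun i)).ae_eq basis_ae.symm
    obtain ⟨h, hh, hA⟩ := hφ (B.basis i) bounded
    suffices h = mulL2 (B.basisFun i) φ by rw [hA, this]
    apply Lp.ext
    filter_upwards [hh, coeFn_multiplication haarAddCircle (B.basisFun i) φ, basis_ae]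
      with t hprod hmul hbasis
    rw [hprod, hmul, hbasis, mul_comm (φ t)]
  · rintro ⟨l, hl⟩
    obtain ⟨A', hA', hl'⟩ := B.exists_mem_asymTruncToeplitz_gram_eq_hankel B' l
    rwa [gram_injective _ _ (hl.trans hl'.symm)]

theorem mem_rankOneToeplitz_iff (A : model α →L[ℂ] model β) :
    A ∈ rankOneToeplitz α β ↔
      ∃ l, (∃ x ≠ 0, ∃ y ≠ 0, hankel m n l = Matrix.vecMulVec x y) ∧
        gram B.basis B'.revBasis A = hankel m n l := by
  have : FiniteDimensional ℂ (model α) := .of_basis B.basis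
  have : FiniteDimensional ℂ (model β) := .of_basis B'.revBasis
  rw [rankOneToeplitz, Set.mem_ofPred_eq, B.mem_asymTruncToeplitz_iff B',
    finrank_range_eq_one_iff_exists_gram_eq B.basis B'.revBasis]
  constructor
  · rintro ⟨⟨l, hl⟩, hA⟩
    exact ⟨l, hl ▸ hA, hl⟩
  · rintro ⟨l, hl, hA⟩
    exact ⟨⟨l, hA⟩, hA ▸ hl⟩

end BlaschkeFactorization

end Blaschke

end ModelSpace

end

theorem mainTheorem6 (α β : ℂ → ℂ) (m n : ℕ) (hm : 0 < m) (hn : 0 < n)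
    (hα : ModelSpace.IsFiniteBlaschkeProduct α m)
    (hβ : ModelSpace.IsFiniteBlaschkeProduct β n) :
    ModelSpace.rankOneToeplitz α β = ModelSpace.kernelTensors α β ↔
      (m * n ≤ 2 ∨ (1 < m ∧ 1 < n)) := by
  obtain ⟨B⟩ := hα.nonempty_factorization
  obtain ⟨B'⟩ := hβ.nonempty_factorization
  rw [← ModelSpace.forall_onRationalNormalCurve_iff (K := ℂ) hm hn]
  constructor
  · intro heq l hl
    obtain ⟨A, -, hA⟩ := B.exists_mem_asymTruncToeplitz_gram_eq_hankel B' l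
    have hmem : A ∈ ModelSpace.kernelTensors α β :=
      heq ▸ (B.mem_rankOneToeplitz_iff B' A).mpr ⟨l, hl, hA⟩
    obtain ⟨l', hl', hA'⟩ := (B.mem_kernelTensors_iff B' hm hn A).mp hmem
    exact hl'.congr fun k hk =>
      ModelSpace.eq_of_hankel_eq_hankel hm hn (hA.symm.trans hA') hk
  · intro h
    ext A
    rw [B.mem_rankOneToeplitz_iff B', B.mem_kernelTensors_iff B' hm hn]
    exact exists_congr fun l =>
      and_congr_left fun _ => ⟨h l, fun hl => hl.exists_hankel_eq_vecMulVec hm hn⟩
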